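/- All graphs are finite and simple, and the graph with no vertices is allowed. For graphs $G$ and $H$, the strong product $G \boxtimes H$ has vertex set $V(G)\times V(H)$, and distinct vertices $(a,v),(b,u)$ are adjacent if and only if ($a=b$ or $ab\in E(G)$) and ($v=u$ or $vu\in E(H)$). A tree-decomposition of $G$ consists of a tree $T$ and bags $B_x\subseteq V(G)$ for $x \in V(T)$ such that for each $v\in V(G)$ the set $\{x\in V(T): v\in B_x\}$ induces a non-empty connected subgraph of $T$, and for each edge $uv\in E(G)$ some bag contains both $u$ and $v$; its width is $\max_{x}(|B_x|-1)$. The treewidth $\mathrm{tw}(G)$ is the minimum width of a tree-decomposition of $G$ (so the graph with no vertices has treewidth $-1$). The Hadwiger number $\eta(H)$ is the maximum integer $t\ge 0$ such that the complete graph $K_t$ is a minor of $H$, that is, a graph isomorphic to $K_t$ can be obtained from $H$ by vertex deletions, edge deletions and edge contractions. For all graphs $G$ and $H$, $$\mathrm{tw}(G\boxtimes H)\ \geq\ \eta(H)\,(\mathrm{tw}(G)+1)-1 .$$ Consequently, for every graph $G$ and every integer $n\ge 0$, $$\mathrm{tw}(G\boxtimes K_n)\ =\ (\mathrm{tw}(G)+1)\,n-1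 .$$ -/

import Mathlib

universe u v

namespace SimpleGraph

/-! ### Graph products -/

/-- The direct product `G × H`: `(a, x)` and `(b, y)` are adjacent iff `ab ∈ E(G)` and
`xy ∈ E(H)`. -/
def directProd {V : Type u} {W : Type v} (G : SimpleGraph V) (H : SimpleGraph W) :
    SimpleGraph (V × W) where
  Adj p q := G.Adj p.1 q.1 ∧ H.Adj p.2 q.2
  symm := ⟨fun _ _ h => ⟨h.1.symm, h.2.symm⟩⟩
  loopless := ⟨fun _ h => G.irrefl h.1⟩

/-- The strong product `G ⊠ H`: the union of the cartesian product and the direct product. -/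
def strongProd {V : Type u} {W : Type v} (G : SimpleGraph V) (H : SimpleGraph W) :
    SimpleGraph (V × W) :=
  (G □ H) ⊔ directProd G H

/-! ### Tree-decompositions and treewidth -/

/-- An `H`-decomposition of `G`, for an arbitrary graph `H` on a set `ι` of nodes. -/
structure Decomposition {V : Type u} {ι : Type v} (G : SimpleGraph V) (H : SimpleGraph ι) where
  /-- The bag of a node. -/
  bag : ι → Finset V
  /-- The nodes whose bags contain a given vertex induce a non-empty connected subgraph. -/
  connected : ∀ a : V, (H.induce {x | a ∈ bag x}).Connected
  /-- Both ends of each edge lie in a common bag. -/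
  edge : ∀ a b : V, G.Adj a b → ∃ x, a ∈ bag x ∧ b ∈ bag x

/-- The width of a decomposition: the maximum of `|B_x| - 1` over all nodes `x`. It is an integer;
it equals `-1` if every bag is empty. -/
def Decomposition.width {V : Type u} {ι : Type v} [Fintype ι] {G : SimpleGraph V}
    {H : SimpleGraph ι} (D : Decomposition G H) : ℤ :=
  ((Finset.univ.sup fun x => (D.bag x).card : ℕ) : ℤ) - 1

/-- The widths of the tree-decompositions of `G`. The nodes of a (finite, non-empty) tree are
taken without loss of generality to be `0, …, m - 1`. -/
def treeDecompositionWidths {V : Type u} (G : SimpleGraph V) : Set ℤ :=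
  {w | ∃ (m : ℕ) (T : SimpleGraph (Fin m)) (D : Decomposition G T), T.IsTree ∧ D.width = w}

/-- The treewidth of a finite graph `G`: the minimum width of a tree-decomposition of `G`.
The graph without vertices has treewidth `-1`. -/
noncomputable def treewidth {V : Type u} (G : SimpleGraph V) : ℤ :=
  sInf G.treeDecompositionWidths

/-- For a finite graph the minimum in the definition of treewidth is attained. -/
theorem isLeast_treewidth {V : Type u} [Finite V] (G : SimpleGraph V) :
    IsLeast G.treeDecompositionWidths G.treewidth := by
  have hb : BddBelow G.treeDecompositionWidths := by
    refine ⟨-1, ?_⟩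
    rintro w ⟨m, T, D, -, rfl⟩
    unfold Decomposition.width
    omega
  have hn : G.treeDecompositionWidths.Nonempty := by
    have := Fintype.ofFinite V
    let D : Decomposition G (⊥ : SimpleGraph (Fin 1)) :=
      { bag := fun _ => Finset.univ
        connected := fun a => by
          have : Nonempty {x : Fin 1 | a ∈ (Finset.univ : Finset V)} := ⟨⟨0, by simp⟩⟩
          exact Connected.mk fun x y => by
            rw [Subsingleton.elim x y]
        edge := fun a b _ => ⟨0, by simp, by simp⟩ }
    exact ⟨D.width, 1, ⊥, D, IsTree.of_subsingleton, rfl⟩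
  exact ⟨Int.csInf_mem hn hb, fun w hw => csInf_le hb hw⟩

/-! ### Minors and the Hadwiger number -/

/-- Contraction of the edge `ab` of `G`: the vertex `b` is removed, and `a`, which represents the
contracted edge, inherits the neighbours of `b`; no loop or parallel edge is kept. -/
def contractEdge {V : Type u} (G : SimpleGraph V) (a b : V) : SimpleGraph {x : V // x ≠ b} :=
  SimpleGraph.fromRel fun x y => G.Adj x y ∨ (x.1 = a ∧ G.Adj b y)

/-- `IsMinor H G`: a graph isomorphic to `H` can be obtained from `G` by a finite sequence of vertex
deletions, edge deletions and edge contractions. -/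
inductive IsMinor {W : Type v} (H : SimpleGraph W) : {V : Type u} → SimpleGraph V → Prop
  | iso {V : Type u} {G : SimpleGraph V} (e : H ≃g G) : IsMinor H G
  | deleteVertex {V : Type u} {G : SimpleGraph V} (a : V)
      (h : IsMinor H (G.induce {x | x ≠ a})) : IsMinor H G
  | deleteEdge {V : Type u} {G : SimpleGraph V} (a b : V) (hab : G.Adj a b)
      (h : IsMinor H (G.deleteEdges {s(a, b)})) : IsMinor H G
  | contractEdge {V : Type u} {G : SimpleGraph V} (a b : V) (hab : G.Adj a b)
      (h : IsMinor H (G.contractEdge a b)) : IsMinor H G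

/-- The Hadwiger number `η(G)` of a finite graph `G`: the maximum `t` such that the complete graph
`K_t` is a minor of `G`. -/
noncomputable def hadwigerNumber {V : Type u} (G : SimpleGraph V) : ℕ :=
  sSup {t : ℕ | IsMinor (⊤ : SimpleGraph (Fin t)) G}

/-- A minor of a finite graph has at most as many vertices as the graph. -/
theorem IsMinor.card_le {W : Type v} {H : SimpleGraph W} {V : Type u} {G : SimpleGraph V}
    (h : IsMinor H G) : Finite V → Nat.card W ≤ Nat.card V := by
  induction h with
  | iso e => intro _; exact (Nat.card_congr e.toEquiv).le
  | deleteVertex a _ ih =>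
    intro _
    exact (ih inferInstance).trans (Nat.card_le_card_of_injective _ Subtype.val_injective)
  | deleteEdge a b _ _ ih => exact ih
  | contractEdge a b _ _ ih =>
    intro _
    exact (ih inferInstance).trans (Nat.card_le_card_of_injective _ Subtype.val_injective)

/-- The graph without vertices is a minor of every finite graph. -/
theorem isMinor_of_isEmpty {W : Type v} [IsEmpty W] (H : SimpleGraph W) (n : ℕ) :
    ∀ {V : Type u} [Finite V] (G : SimpleGraph V), Nat.card V = n → IsMinor H G := by
  induction n with
  | zero =>
    intro V _ G hV
    have : IsEmpty V := Finite.card_eq_zero_iff.mp hV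
    exact .iso ⟨Equiv.equivOfIsEmpty W V, fun {a} => isEmptyElim a⟩
  | succ n ih =>
    intro V _ G hV
    have hne : Nonempty V := (Nat.card_pos_iff.mp (by omega)).1
    obtain ⟨a⟩ := hne
    refine .deleteVertex a (ih _ ?_)
    have h1 := Set.ncard_add_ncard_compl ({a} : Set V)
    rw [Set.ncard_singleton, hV] at h1
    have h2 : Nat.card {x : V | x ≠ a} = ({a}ᶜ : Set V).ncard := rfl
    omega

/-- For a finite graph the maximum in the definition of the Hadwiger number is attained. -/
theorem isGreatest_hadwigerNumber {V : Type u} [Finite V] (G : SimpleGraph V) :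
    IsGreatest {t : ℕ | IsMinor (⊤ : SimpleGraph (Fin t)) G} G.hadwigerNumber := by
  have hb : BddAbove {t : ℕ | IsMinor (⊤ : SimpleGraph (Fin t)) G} :=
    ⟨Nat.card V, fun t ht => by simpa using IsMinor.card_le ht inferInstance⟩
  have hn : {t : ℕ | IsMinor (⊤ : SimpleGraph (Fin t)) G}.Nonempty :=
    ⟨0, isMinor_of_isEmpty _ _ G rfl⟩
  exact ⟨Nat.sSup_mem hn hb, fun t ht => le_csSup hb ht⟩

end SimpleGraph

/-! The heart is the lower bound for `G ⊠ K_n`. Given a tree-decomposition of `G ⊠ K_n`, keep the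
tree and put `a` in the new bag at `x` when the whole fibre `{a} × K_n` lies in the old bag. The
fibre of a vertex, and the union of the fibres over an edge, are cliques, so by the Helly property
of subtrees each lies in some bag; hence this is a tree-decomposition of `G`. Each old bag is at
least `n` times as large as the new one. Blowing up the bags of `G` by `K_n` gives the matching
upper bound. For general `H`, `tw(G ⊠ H)` does not increase when `H` is replaced by a minor, which
is checked one minor operation at a time; the minor `K_t` with `t = η(H)` then reduces to the
complete case. -/

namespace SimpleGraph

/-! ### Subtrees of a tree -/

/-- A set of nodes that contains every path between two of its members. -/
def PathClosed {ι : Type v} (T : SimpleGraph ι) (S : Set ι) : Prop :=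
  ∀ ⦃x y : ι⦄, x ∈ S → y ∈ S → ∀ p : T.Walk x y, p.IsPath → ∀ z ∈ p.support, z ∈ S

theorem PathClosed.inter {ι : Type v} {T : SimpleGraph ι} {S S' : Set ι} (h : T.PathClosed S)
    (h' : T.PathClosed S') : T.PathClosed (S ∩ S') :=
  fun _ _ hx hy p hp z hz => ⟨h hx.1 hy.1 p hp z hz, h' hx.2 hy.2 p hp z hz⟩

theorem PathClosed.iInter {ι : Type v} {κ : Type*} {T : SimpleGraph ι} {S : κ → Set ι}
    (h : ∀ k, T.PathClosed (S k)) : T.PathClosed (⋂ k, S k) :=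
  fun _ _ hx hy p hp z hz => Set.mem_iInter.2 fun k =>
    h k (Set.mem_iInter.1 hx k) (Set.mem_iInter.1 hy k) p hp z hz

/-- Connected sets of nodes of a forest are closed under paths. -/
theorem IsAcyclic.pathClosed {ι : Type v} {T : SimpleGraph ι} (hT : T.IsAcyclic) {S : Set ι}
    (hS : (T.induce S).Connected) : T.PathClosed S := by
  classical
  intro x y hx hy p hp z hz
  obtain ⟨w⟩ := hS.preconnected ⟨x, hx⟩ ⟨y, hy⟩
  let w' : T.Walk x y := w.map (Embedding.induce S).toHom
  have hw : ∀ z ∈ w'.support, z ∈ S := by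
    intro z hz
    rw [show w'.support = _ from Walk.support_map _ w, List.mem_map] at hz
    obtain ⟨a, -, rfl⟩ := hz
    exact a.2
  -- Paths in a forest are unique, so `p` is the shortcut of a walk that stays in `S`.
  have hpw : p = w'.bypass :=
    congrArg Subtype.val
      ((hT.subsingleton_path x y).elim ⟨p, hp⟩ ⟨w'.bypass, w'.bypass_isPath⟩)
  rw [hpw] at hz
  exact hw z (w'.support_bypass_subset_support hz)

theorem Connected.induce_of_pathClosed {ι : Type v} {T : SimpleGraph ι} (hT : T.Connected)
    {S : Set ι} (hS : T.PathClosed S) (hne : S.Nonempty) : (T.induce S).Connected := by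
  have : Nonempty S := hne.to_subtype
  refine Connected.mk fun x y => ?_
  obtain ⟨p, hp⟩ := hT.exists_isPath x.1 y.1
  exact ⟨p.induce S (hS x.2 y.2 p hp)⟩

/-- A walk from `C` to `B` each edge of which lies within `B` or within `C` meets `B ∩ C`. -/
theorem Walk.exists_mem_inter {ι : Type v} {T : SimpleGraph ι} {B C : Set ι} {x y : ι}
    (p : T.Walk x y) (hx : x ∈ C) (hy : y ∈ B)
    (hp : ∀ a b, s(a, b) ∈ p.edges → a ∈ B ∧ b ∈ B ∨ a ∈ C ∧ b ∈ C) :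
    ∃ z ∈ p.support, z ∈ B ∩ C := by
  induction p with
  | nil => exact ⟨_, by simp, hy, hx⟩
  | @cons a b c hab p ih =>
    rcases hp a b (by simp) with h | h
    · exact ⟨a, by simp, h.1, hx⟩
    · obtain ⟨z, hz, hz'⟩ := ih h.2 hy fun u v huv => hp u v (by simp [huv])
      exact ⟨z, by simp [hz], hz'⟩

/-- Helly property for three subtrees of a tree. -/
theorem IsTree.helly_three {ι : Type v} {T : SimpleGraph ι} (hT : T.IsTree) {A B C : Set ι}
    (hA : T.PathClosed A) (hB : T.PathClosed B) (hC : T.PathClosed C) (hBC : (B ∩ C).Nonempty)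
    (hAC : (A ∩ C).Nonempty) (hAB : (A ∩ B).Nonempty) : (A ∩ B ∩ C).Nonempty := by
  classical
  obtain ⟨a, haB, haC⟩ := hBC
  obtain ⟨b, hbA, hbC⟩ := hAC
  obtain ⟨c, hcA, hcB⟩ := hAB
  obtain ⟨p, hp⟩ := hT.1.exists_isPath b a
  obtain ⟨q, hq⟩ := hT.1.exists_isPath a c
  -- `p` stays in `C` and `q` in `B`, so the `b`–`c` path cut from their concatenation must pass
  -- from `C` to `B`; as both its ends are in `A`, it stays in `A`.
  obtain ⟨z, hz, hz'⟩ := (p.append q).bypass.exists_mem_inter hbC hcB (B := B) (C := C) (by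
    intro u v huv
    have := (p.append q).edges_bypass_subset_edges huv
    rw [Walk.edges_append, List.mem_append] at this
    rcases this with h | h
    · exact .inr ⟨hC hbC haC p hp _ (p.fst_mem_support_of_mem_edges h),
        hC hbC haC p hp _ (p.snd_mem_support_of_mem_edges h)⟩
    · exact .inl ⟨hB haB hcB q hq _ (q.fst_mem_support_of_mem_edges h),
        hB haB hcB q hq _ (q.snd_mem_support_of_mem_edges h)⟩)
  exact ⟨z, ⟨hA hbA hcA _ (Walk.bypass_isPath _) z hz, hz'.1⟩, hz'.2⟩

/-- Helly property for subtrees of a tree. -/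
theorem IsTree.helly {ι : Type v} {κ : Type*} {T : SimpleGraph ι} (hT : T.IsTree)
    (s : Finset κ) {S : κ → Set ι} (hS : ∀ k, T.PathClosed (S k))
    (hpair : ∀ k l, (S k ∩ S l).Nonempty) : (⋂ k ∈ s, S k).Nonempty := by
  classical
  induction s using Finset.induction_on generalizing S with
  | empty =>
    have := hT.1.nonempty
    simp
  | insert a s ha ih =>
    -- Intersecting the family with `S a` keeps it pairwise meeting, by the case of three subtrees.
    obtain ⟨z, hz⟩ := ih (S := fun k => S a ∩ S k) (fun k => (hS a).inter (hS k)) fun k l => by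
      have := hT.helly_three (hS a) (hS k) (hS l) (hpair k l) (hpair a l) (hpair a k)
      exact this.mono fun x hx => ⟨hx.1, hx.1.1, hx.2⟩
    simp only [Set.mem_iInter] at hz
    rcases s.eq_empty_or_nonempty with rfl | ⟨k, hk⟩
    · simpa using hpair a a
    · refine ⟨z, ?_⟩
      simp only [Set.mem_iInter, Finset.mem_insert, forall_eq_or_imp]
      exact ⟨(hz k hk).1, fun l hl => (hz l hl).2⟩

/-- In a tree-decomposition, every clique is contained in a bag. -/
theorem Decomposition.exists_bag_of_clique {V : Type u} {ι : Type v} {G : SimpleGraph V}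
    {T : SimpleGraph ι} (hT : T.IsTree) (D : Decomposition G T) {κ : Type*} [Finite κ]
    (f : κ → V) (hf : ∀ k l, f k = f l ∨ G.Adj (f k) (f l)) : ∃ x, ∀ k, f k ∈ D.bag x := by
  have := Fintype.ofFinite κ
  obtain ⟨x, hx⟩ := hT.helly (Finset.univ : Finset κ) (S := fun k => {x | f k ∈ D.bag x})
    (fun k => hT.isAcyclic.pathClosed (D.connected _)) (by
      intro k l
      rcases hf k l with h | h
      · obtain ⟨⟨x, hx⟩⟩ := (D.connected (f k)).nonempty
        exact ⟨x, hx, h ▸ hx⟩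
      · exact D.edge _ _ h)
  exact ⟨x, by simpa using hx⟩

/-! ### Treewidth bounds -/

theorem Decomposition.width_le_iff {V : Type u} {ι : Type v} [Fintype ι] {G : SimpleGraph V}
    {H : SimpleGraph ι} (D : Decomposition G H) (k : ℕ) :
    D.width ≤ (k : ℤ) - 1 ↔ ∀ x, (D.bag x).card ≤ k := by
  have : D.width ≤ (k : ℤ) - 1 ↔ (Finset.univ.sup fun x => (D.bag x).card) ≤ k := by
    unfold Decomposition.width
    omega
  rw [this, Finset.sup_le_iff]
  simp

/-- Working with the bag size `k`, a natural number, absorbs the width `-1` as the case `k = 0`. -/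
theorem treewidth_le_iff {V : Type u} [Finite V] (G : SimpleGraph V) (k : ℕ) :
    G.treewidth ≤ (k : ℤ) - 1 ↔ ∃ (m : ℕ) (T : SimpleGraph (Fin m)) (D : Decomposition G T),
      T.IsTree ∧ ∀ x, (D.bag x).card ≤ k := by
  constructor
  · intro h
    obtain ⟨m, T, D, hT, hD⟩ := G.isLeast_treewidth.1
    exact ⟨m, T, D, hT, (D.width_le_iff k).1 (hD ▸ h)⟩
  · rintro ⟨m, T, D, hT, hD⟩
    exact (G.isLeast_treewidth.2 ⟨m, T, D, hT, rfl⟩).trans ((D.width_le_iff k).2 hD)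

theorem exists_treewidth_eq {V : Type u} [Finite V] (G : SimpleGraph V) :
    ∃ k : ℕ, G.treewidth = (k : ℤ) - 1 := by
  obtain ⟨m, T, D, -, hD⟩ := G.isLeast_treewidth.1
  exact ⟨_, hD.symm⟩

theorem strongProd_adj {V : Type u} {W : Type v} {G : SimpleGraph V} {H : SimpleGraph W}
    {p q : V × W} : (G.strongProd H).Adj p q ↔
      p ≠ q ∧ (p.1 = q.1 ∨ G.Adj p.1 q.1) ∧ (p.2 = q.2 ∨ H.Adj p.2 q.2) := by
  have hG : G.Adj p.1 q.1 → p.1 ≠ q.1 := fun h => h.ne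
  have hH : H.Adj p.2 q.2 → p.2 ≠ q.2 := fun h => h.ne
  have : p = q ↔ p.1 = q.1 ∧ p.2 = q.2 := Prod.ext_iff
  simp only [strongProd, directProd, sup_adj, boxProd_adj]
  tauto

/-! ### Strong products and minors -/

/-- Treewidth does not increase from `X` to `Y` if the vertices `u` of `Y` are represented by
disjoint sets `{p u, q u}`, each a vertex or an edge of `X`. -/
theorem treewidth_le_of_pairs {V : Type u} {U : Type v} [Finite V] [Finite U]
    {X : SimpleGraph V} {Y : SimpleGraph U} (p q : U → V) (c : V → Option U)
    (hp : ∀ u, c (p u) = some u) (hq : ∀ u, c (q u) = some u)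
    (hpq : ∀ u, p u = q u ∨ X.Adj (p u) (q u))
    (hadj : ∀ u u', Y.Adj u u' →
      ∃ s t, (s = p u ∨ s = q u) ∧ (t = p u' ∨ t = q u') ∧ X.Adj s t) :
    Y.treewidth ≤ X.treewidth := by
  classical
  have := Fintype.ofFinite U
  obtain ⟨k, hk⟩ := X.exists_treewidth_eq
  obtain ⟨m, T, D, hT, hD⟩ := (X.treewidth_le_iff k).1 hk.le
  rw [hk, treewidth_le_iff]
  refine ⟨m, T, ⟨fun x => {u | p u ∈ D.bag x ∨ q u ∈ D.bag x}, ?_, ?_⟩, hT, ?_⟩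
  · intro u
    have hset : {x | u ∈ (Finset.univ.filter fun u => p u ∈ D.bag x ∨ q u ∈ D.bag x)} =
        {x | p u ∈ D.bag x} ∪ {x | q u ∈ D.bag x} := by
      ext x
      simp
    rw [hset]
    refine induce_union_connected (D.connected _).preconnected (D.connected _).preconnected ?_
    rcases hpq u with h | h
    · obtain ⟨⟨x, hx⟩⟩ := (D.connected (p u)).nonempty
      exact ⟨x, hx, h ▸ hx⟩
    · exact D.edge _ _ h
  · intro u u' h
    obtain ⟨s, t, hs, ht, hst⟩ := hadj u u' h
    obtain ⟨x, hx, hx'⟩ := D.edge s t hst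
    refine ⟨x, ?_, ?_⟩
    · rcases hs with rfl | rfl <;> simp [hx]
    · rcases ht with rfl | rfl <;> simp [hx']
  · intro x
    refine le_trans ?_ (hD x)
    -- `c` sends a representative back to the vertex it represents, so the new bag lies in the image
    -- of the old one under `c`.
    rw [← Finset.card_map Function.Embedding.some]
    refine (Finset.card_le_card (t := (D.bag x).image c) ?_).trans Finset.card_image_le
    intro o ho
    simp only [Finset.mem_map, Finset.mem_filter, Finset.mem_univ, true_and] at ho
    obtain ⟨u, hu | hu, rfl⟩ := ho
    · exact Finset.mem_image.2 ⟨_, hu, hp u⟩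
    · exact Finset.mem_image.2 ⟨_, hu, hq u⟩

/-- Representing each vertex by at most an edge is enough for a single minor operation, and such a
representation lifts to each copy of the factor in the product. -/
theorem treewidth_strongProd_le_of_pairs {V : Type*} {W : Type*} {U : Type*} [Finite V]
    [Finite W] [Finite U] (G : SimpleGraph V) {X : SimpleGraph W} {Y : SimpleGraph U}
    (p q : U → W) (c : W → Option U)
    (hp : ∀ u, c (p u) = some u) (hq : ∀ u, c (q u) = some u)
    (hpq : ∀ u, p u = q u ∨ X.Adj (p u) (q u))
    (hadj : ∀ u u', Y.Adj u u' →
      ∃ s t, (s = p u ∨ s = q u) ∧ (t = p u' ∨ t = q u') ∧ X.Adj s t) :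
    (G.strongProd Y).treewidth ≤ (G.strongProd X).treewidth := by
  refine treewidth_le_of_pairs (fun u => (u.1, p u.2)) (fun u => (u.1, q u.2))
    (fun w => (c w.2).map fun u => (w.1, u)) (by simp [hp]) (by simp [hq]) ?_ ?_
  · intro u
    rcases hpq u.2 with h | h
    · exact .inl (by rw [h])
    · exact .inr (strongProd_adj.2 ⟨fun e => h.ne (congrArg Prod.snd e), .inl rfl, .inr h⟩)
  · rintro ⟨g, x⟩ ⟨g', x'⟩ h
    obtain ⟨hne, hg, hx⟩ := strongProd_adj.1 h
    rcases hx with hx | hx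
    · obtain rfl : x = x' := hx
      refine ⟨_, _, .inl rfl, .inl rfl, strongProd_adj.2 ⟨fun e => hne ?_, hg, .inl rfl⟩⟩
      exact Prod.ext (congrArg Prod.fst e :) rfl
    · obtain ⟨s, t, hs, ht, hst⟩ := hadj _ _ hx
      refine ⟨(g, s), (g', t), ?_, ?_,
        strongProd_adj.2 ⟨fun e => hst.ne (congrArg Prod.snd e), hg, .inr hst⟩⟩
      · rcases hs with rfl | rfl <;> simp
      · rcases ht with rfl | rfl <;> simp

/-- If `K` is a minor of `H`, then `tw(G ⊠ K) ≤ tw(G ⊠ H)`. -/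
theorem IsMinor.treewidth_strongProd_le {U : Type*} {W : Type*} {V : Type*} [Finite V] [Finite U]
    (G : SimpleGraph V) {K : SimpleGraph U} {H : SimpleGraph W} (h : IsMinor K H) :
    Finite W → (G.strongProd K).treewidth ≤ (G.strongProd H).treewidth := by
  classical
  induction h with
  | iso e =>
    intro _
    exact treewidth_strongProd_le_of_pairs G e e (fun w => some (e.symm w)) (by simp) (by simp)
      (fun _ => .inl rfl) fun u u' h => ⟨_, _, .inl rfl, .inl rfl, e.map_adj_iff.2 h⟩
  | @deleteVertex W H a _ ih =>
    intro _
    refine (ih inferInstance).trans ?_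
    exact treewidth_strongProd_le_of_pairs G Subtype.val Subtype.val
      (fun w => if h : w ≠ a then some ⟨w, h⟩ else none)
      (fun u => dif_pos u.2) (fun u => dif_pos u.2)
      (fun _ => .inl rfl) fun u u' h => ⟨_, _, .inl rfl, .inl rfl, h⟩
  | deleteEdge a b _ _ ih =>
    intro _
    refine (ih inferInstance).trans ?_
    exact treewidth_strongProd_le_of_pairs G id id some (fun _ => rfl) (fun _ => rfl)
      (fun _ => .inl rfl) fun u u' h => ⟨_, _, .inl rfl, .inl rfl, deleteEdges_le _ h⟩
  | @contractEdge W H a b hab _ ih =>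
    intro _
    refine (ih inferInstance).trans ?_
    -- The contracted vertex `a` is represented by the edge `ab`, every other vertex by itself.
    refine treewidth_strongProd_le_of_pairs G Subtype.val
      (fun u => if u.1 = a then b else u.1)
      (fun w => if h : w ≠ b then some ⟨w, h⟩ else some ⟨a, hab.ne⟩)
      (fun u => dif_pos u.2) ?_ ?_ ?_
    · rintro ⟨u, hu⟩
      by_cases h : u = a
      · simp [h]
      · simp [h, hu]
    · rintro ⟨u, hu⟩
      by_cases h : u = a
      · subst h
        simp [hab]
      · simp [h]
    · rintro ⟨u, hu⟩ ⟨u', hu'⟩ h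
      obtain ⟨-, (h | ⟨rfl, h'⟩) | (h | ⟨rfl, h'⟩)⟩ := (fromRel_adj _ _ _).1 h
      · exact ⟨_, _, .inl rfl, .inl rfl, h⟩
      · exact ⟨b, u', by simp, .inl rfl, h'⟩
      · exact ⟨_, _, .inl rfl, .inl rfl, h.symm⟩
      · exact ⟨u, b, .inl rfl, by simp, h'.symm⟩

/-! ### Products with complete graphs -/

theorem treewidth_strongProd_top_le {V : Type u} [Finite V] (G : SimpleGraph V) (n : ℕ) :
    (G.strongProd (⊤ : SimpleGraph (Fin n))).treewidth ≤ (G.treewidth + 1) * n - 1 := by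
  obtain ⟨k, hk⟩ := G.exists_treewidth_eq
  obtain ⟨m, T, D, hT, hD⟩ := (G.treewidth_le_iff k).1 hk.le
  have hkn : (G.treewidth + 1) * n - 1 = ((k * n : ℕ) : ℤ) - 1 := by
    rw [hk]
    push_cast
    ring
  rw [hkn, treewidth_le_iff]
  refine ⟨m, T, ⟨fun x => D.bag x ×ˢ Finset.univ, ?_, ?_⟩, hT, ?_⟩
  · intro a
    have hset : {x | a ∈ D.bag x ×ˢ Finset.univ} = {x | a.1 ∈ D.bag x} := by
      ext x
      simp
    rw [hset]
    exact D.connected a.1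
  · intro a b h
    rcases (strongProd_adj.1 h).2.1 with h | h
    · obtain ⟨⟨x, hx⟩⟩ := (D.connected a.1).nonempty
      have hx : a.1 ∈ D.bag x := hx
      exact ⟨x, by simpa using hx, by simpa [← h] using hx⟩
    · simpa using D.edge _ _ h
  · intro x
    simpa using Nat.mul_le_mul_right n (hD x)

theorem le_treewidth_strongProd_top {V : Type u} [Finite V] (G : SimpleGraph V) (n : ℕ) :
    (G.treewidth + 1) * n - 1 ≤ (G.strongProd (⊤ : SimpleGraph (Fin n))).treewidth := by
  classical
  have := Fintype.ofFinite V
  -- The division by `n` below needs `n > 0`; for `n = 0` the bound is `-1`.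
  rcases Nat.eq_zero_or_pos n with rfl | hn
  · obtain ⟨k, hk⟩ := (G.strongProd (⊤ : SimpleGraph (Fin 0))).exists_treewidth_eq
    rw [hk]
    push_cast
    omega
  obtain ⟨k, hk⟩ := (G.strongProd (⊤ : SimpleGraph (Fin n))).exists_treewidth_eq
  obtain ⟨m, T, D, hT, hD⟩ := (treewidth_le_iff _ k).1 hk.le
  have key : G.treewidth ≤ ((k / n : ℕ) : ℤ) - 1 := by
    rw [treewidth_le_iff]
    refine ⟨m, T, ⟨fun x => {a | ∀ i, (a, i) ∈ D.bag x}, ?_, ?_⟩, hT, ?_⟩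
    · intro a
      have hset : {x | a ∈ (Finset.univ.filter fun a => ∀ i, (a, i) ∈ D.bag x)} =
          ⋂ i : Fin n, {x | (a, i) ∈ D.bag x} := by
        ext x
        simp
      rw [hset]
      -- An intersection of subtrees is connected once it is non-empty, and Helly applied to the
      -- fibre of `a` supplies a common node.
      refine hT.1.induce_of_pathClosed
        (.iInter fun i => hT.isAcyclic.pathClosed (D.connected _)) ?_
      obtain ⟨x, hx⟩ := D.exists_bag_of_clique hT (fun i : Fin n => (a, i)) fun i j => by
        by_cases h : i = j
        · exact .inl (by rw [h])
        · exact .inr (strongProd_adj.2 ⟨by simp [h], .inl rfl, .inr h⟩)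
      exact ⟨x, Set.mem_iInter.2 hx⟩
    · intro a b hab
      -- The `Bool` coordinate selects an end of `ab`, so this family is the clique formed by both
      -- fibres.
      obtain ⟨x, hx⟩ := D.exists_bag_of_clique hT
        (fun p : Bool × Fin n => (if p.1 then a else b, p.2)) fun p q => by
          by_cases h : (if p.1 then a else b, p.2) = (if q.1 then a else b, q.2)
          · exact .inl h
          · refine .inr (strongProd_adj.2 ⟨h, ?_, ?_⟩)
            · rcases p with ⟨_ | _, _⟩ <;> rcases q with ⟨_ | _, _⟩ <;> simp [hab, hab.symm]
            · exact eq_or_ne p.2 q.2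
      exact ⟨x, by simpa using fun i => hx (true, i), by simpa using fun i => hx (false, i)⟩
    · intro x
      rw [Nat.le_div_iff_mul_le hn]
      refine le_trans ?_ (hD x)
      have hsub : (Finset.univ.filter fun a => ∀ i, (a, i) ∈ D.bag x) ×ˢ
          (Finset.univ : Finset (Fin n)) ⊆ D.bag x := by
        intro p hp
        simp only [Finset.mem_product, Finset.mem_filter, Finset.mem_univ, true_and, and_true] at hp
        exact hp p.2
      simpa using Finset.card_le_card hsub
  have hdiv : ((k / n : ℕ) : ℤ) * n ≤ k := by exact_mod_cast Nat.div_mul_le_self k n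
  have hmul : (G.treewidth + 1) * n ≤ ((k / n : ℕ) : ℤ) * n :=
    mul_le_mul_of_nonneg_right (by linarith) (by positivity)
  rw [hk]
  linarith

end SimpleGraph

theorem mainTheorem6 {V : Type u} [Finite V] (G : SimpleGraph V) :
    (∀ {W : Type v} [Finite W] (H : SimpleGraph W),
      (G.strongProd H).treewidth ≥ (H.hadwigerNumber : ℤ) * (G.treewidth + 1) - 1) ∧
    ∀ n : ℕ, (G.strongProd (⊤ : SimpleGraph (Fin n))).treewidth = (G.treewidth + 1) * n - 1 := by
  refine ⟨fun H => ?_, fun n =>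
    (G.treewidth_strongProd_top_le n).antisymm (G.le_treewidth_strongProd_top n)⟩
  have h1 := G.le_treewidth_strongProd_top H.hadwigerNumber
  have h2 := H.isGreatest_hadwigerNumber.1.treewidth_strongProd_le G inferInstance
  rw [mul_comm] at h1
  exact h1.trans h2
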